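/- Let $\mathcal H$ be a complex Hilbert space with inner product $(\cdot,\cdot)$ and norm $\|\cdot\|$, and let $H$ be a densely defined, self-adjoint, nonnegative operator on $\mathcal H$ with domain $\mathrm{Dom}(H)$. Its spectrum $\sigma(H)$ is the set of $z\in\mathbb C$ for which $H-z:\mathrm{Dom}(H)\to\mathcal H$ has no bounded inverse, and its essential spectrum $\sigma_{\mathrm{ess}}(H)\subset\sigma(H)$ consists of the cluster points of $\sigma(H)$ and of the eigenvalues of infinite multiplicity. Let $\lambda\ge 0$ be a real number. (a) $\lambda\in\sigma(H)$ if and only if there exist a constant $\alpha>0$ and a sequence $\{\psi_j\}_{j\in\mathbb N}\subset\mathrm{Dom}(H)$ such that 1. $\|\psi_j\|=1$ for all $j$, and 2. $((H+\alpha)^{-m}\psi_j,(H-\lambda)\psi_j)\to 0$ as $j\to\infty$, for $m=1$ and $m=2$. (b) $\lambda\in\sigma_{\mathrm{ess}}(H)$ if and only if there exist a constant $\alpha>0$ and a sequence $\{\psi_j\}_{j\in\mathbb N}\subset\mathrm{Dom}(H)$ satisfying 1, 2 and 3. $\psi_j\to 0$ weakly in $\mathcal H$ as $j\to\infty$. (c)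 For all real $\lambda\ge 0$, $\alpha>0$ and $0<\delta_0<1$ there is a constant $c=c(\lambda,\alpha,\delta_0)>0$, depending on nothing else (in particular not on $\mathcal H$ or $H$), such that the following holds for all $\mathcal H$ and $H$ as above and all $0<\delta\le\delta_0$. If $\{\psi_j\}_{j\in\mathbb N}\subset\mathrm{Dom}(H)$ is a sequence of unit vectors with $$|((H+\alpha)^{-m}\psi_j,(H-\lambda)\psi_j)|\le\delta\qquad\text{for } m=1,2 \text{ and all } j,$$ then $\sigma(H)\neq\emptyset$ and $$\mathrm{dist}(\lambda,\sigma(H))<c\,\delta^{1/3}.$$ -/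

import Mathlib

open Filter Topology

universe u

namespace WeylCriterion

noncomputable section

variable {E : Type*} [NormedAddCommGroup E] [InnerProductSpace ℂ E]

/-- `R` is the bounded, everywhere defined two-sided inverse `(H - z)⁻¹` of
`H - z : Dom(H) → E`. -/
def IsResolventAt (H : E →ₗ.[ℂ] E) (z : ℂ) (R : E →L[ℂ] E) : Prop :=
  (∀ x : E, ∃ h : R x ∈ H.domain, H ⟨R x, h⟩ - z • R x = x) ∧
    ∀ x : H.domain, R (H x - z • (x : E)) = x

/-- The spectrum `σ(H)` of a possibly unbounded operator: the complex numbers `z` for which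
`H - z` has no bounded inverse. -/
def spectrum (H : E →ₗ.[ℂ] E) : Set ℂ :=
  {z | ¬ ∃ R : E →L[ℂ] E, IsResolventAt H z R}

/-- The eigenspace `{x ∈ Dom(H) | H x = z x}`. -/
def eigenspace (H : E →ₗ.[ℂ] E) (z : ℂ) : Submodule ℂ E :=
  (LinearMap.ker (H.toFun - z • H.domain.subtype)).map H.domain.subtype

/-- The essential spectrum `σ_ess(H)` of a self-adjoint operator: the points of `σ(H)` that are
cluster points of `σ(H)` or eigenvalues of infinite multiplicity. -/
def essentialSpectrum (H : E →ₗ.[ℂ] E) : Set ℂ :=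
  {z | z ∈ spectrum H ∧
    (AccPt z (𝓟 (spectrum H)) ∨ ¬ FiniteDimensional ℂ (eigenspace H z))}

/-- `H` is nonnegative: `(H x, x) ≥ 0` on its domain. For a self-adjoint `H` the inner product
is real. -/
def Nonnegative (H : E →ₗ.[ℂ] E) : Prop :=
  ∀ x : H.domain, 0 ≤ (inner ℂ (H x) (x : E)).re

open scoped Classical in
/-- The bounded operator `(H + α)⁻¹`. For nonnegative self-adjoint `H` and `α > 0` it exists, see
`isResolventAt_shiftInv`, so that the default value `0` is not used. -/
def shiftInv (H : E →ₗ.[ℂ] E) (α : ℝ) : E →L[ℂ] E :=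
  if h : ∃ R : E →L[ℂ] E, IsResolventAt H (-(α : ℂ)) R then h.choose else 0

/-- The pairing `((H + α)⁻ᵐ ψ, (H - lam) ψ)` for `ψ ∈ Dom(H)`. -/
def weylPairing (H : E →ₗ.[ℂ] E) (α lam : ℝ) (m : ℕ) (ψ : H.domain) : ℂ :=
  inner ℂ ((shiftInv H α ^ m) (ψ : E)) (H ψ - (lam : ℂ) • (ψ : E))

/-! Facts which show that the definitions above are well posed. -/

theorem IsResolventAt.unique {H : E →ₗ.[ℂ] E} {z : ℂ} {R S : E →L[ℂ] E}
    (hR : IsResolventAt H z R) (hS : IsResolventAt H z S) : R = S := by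
  ext x
  obtain ⟨h, hx⟩ := hR.1 x
  have := hS.2 ⟨R x, h⟩
  simp only [hx] at this
  exact this.symm

theorem mem_eigenspace {H : E →ₗ.[ℂ] E} {z : ℂ} {x : E} :
    x ∈ eigenspace H z ↔ ∃ h : x ∈ H.domain, H ⟨x, h⟩ = z • x := by
  simp only [eigenspace, Submodule.mem_map, LinearMap.mem_ker, LinearMap.sub_apply,
    LinearMap.smul_apply, sub_eq_zero, Submodule.subtype_apply, Subtype.exists]
  constructor
  · rintro ⟨a, ha, h, rfl⟩
    exact ⟨ha, h⟩
  · rintro ⟨h, hx⟩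
    exact ⟨x, h, hx, rfl⟩

theorem norm_le_of_nonnegative {H : E →ₗ.[ℂ] E} (hH : Nonnegative H) (α : ℝ) (x : H.domain) :
    α * ‖(x : E)‖ ≤ ‖H x + (α : ℂ) • (x : E)‖ := by
  rcases eq_or_ne (x : E) 0 with h0 | h0
  · rw [h0]; simp
  have hpos : 0 < ‖(x : E)‖ := norm_pos_iff.mpr h0
  have h1 : α * ‖(x : E)‖ ^ 2 ≤ (inner ℂ (H x + (α : ℂ) • (x : E)) (x : E)).re := by
    have hx : inner ℂ (x : E) (x : E) = ((‖(x : E)‖ ^ 2 : ℝ) : ℂ) := by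
      rw [inner_self_eq_norm_sq_to_K]; norm_cast
    rw [inner_add_left, inner_smul_left, hx, Complex.conj_ofReal, ← Complex.ofReal_mul,
      Complex.add_re, Complex.ofReal_re]
    have := hH x
    linarith
  have h2 : (inner ℂ (H x + (α : ℂ) • (x : E)) (x : E)).re ≤
      ‖H x + (α : ℂ) • (x : E)‖ * ‖(x : E)‖ :=
    (Complex.re_le_norm _).trans (norm_inner_le_norm _ _)
  have h3 : (α * ‖(x : E)‖) * ‖(x : E)‖ ≤ ‖H x + (α : ℂ) • (x : E)‖ * ‖(x : E)‖ := by
    nlinarith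
  exact le_of_mul_le_mul_right h3 hpos

theorem exists_isResolventAt_neg [CompleteSpace E] {H : E →ₗ.[ℂ] E} (hsa : IsSelfAdjoint H)
    (hH : Nonnegative H) {α : ℝ} (hα : 0 < α) :
    ∃ R : E →L[ℂ] E, IsResolventAt H (-(α : ℂ)) R := by
  have hb := norm_le_of_nonnegative hH α
  let T : H.domain →ₗ[ℂ] E := H.toFun + (α : ℂ) • H.domain.subtype
  have hT : ∀ x, T x = H x + (α : ℂ) • (x : E) := fun x => rfl
  have hinj : Function.Injective T := by
    rw [injective_iff_map_eq_zero]
    intro x hx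
    have := hb x
    rw [← hT, hx, norm_zero] at this
    have h0 : ‖(x : E)‖ ≤ 0 := by
      by_contra hc
      push Not at hc
      nlinarith [mul_pos hα hc]
    exact Subtype.ext (norm_le_zero_iff.mp h0)
  have hclosed : IsClosed (LinearMap.range T : Set E) := by
    rw [← isSeqClosed_iff_isClosed]
    intro u y hu huy
    choose v hv using hu
    have hcauchy : CauchySeq (fun n => (v n : E)) := by
      rw [Metric.cauchySeq_iff]
      intro ε hε
      obtain ⟨N, hN⟩ := Metric.cauchySeq_iff.mp huy.cauchySeq (α * ε) (mul_pos hα hε)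
      refine ⟨N, fun m hm n hn => ?_⟩
      have h1 := hN m hm n hn
      have h2 := hb (v m - v n)
      rw [← hT, map_sub, hv, hv, ← dist_eq_norm, Submodule.coe_sub, ← dist_eq_norm] at h2
      exact lt_of_mul_lt_mul_left (h2.trans_lt h1) hα.le
    obtain ⟨x, hx⟩ := cauchySeq_tendsto_of_complete hcauchy
    have hHv : Tendsto (fun n => H (v n)) atTop (𝓝 (y - (α : ℂ) • x)) := by
      have : (fun n => H (v n)) = fun n => u n - (α : ℂ) • (v n : E) := by
        funext n
        rw [← hv n, hT]; abel
      rw [this]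
      exact huy.sub (hx.const_smul _)
    have hg : (x, y - (α : ℂ) • x) ∈ H.graph := by
      have hc : IsClosed (H.graph : Set (E × E)) := hsa.isClosed
      exact hc.mem_of_tendsto (hx.prodMk_nhds hHv)
        (Eventually.of_forall fun n => H.mem_graph (v n))
    rw [LinearPMap.mem_graph_iff] at hg
    obtain ⟨w, hw1, hw2⟩ := hg
    simp only at hw1 hw2
    exact ⟨w, by rw [hT, hw1, hw2]; abel⟩
  have hsurj : LinearMap.range T = ⊤ := by
    have : CompleteSpace (LinearMap.range T) := hclosed.completeSpace_coe
    rw [← Submodule.orthogonal_eq_bot_iff, Submodule.eq_bot_iff]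
    intro y hy
    rw [Submodule.mem_orthogonal'] at hy
    have hadj : ∀ x : H.domain, inner ℂ (-(α : ℂ) • y) (x : E) = inner ℂ y (H x) := by
      intro x
      have := hy (T x) ⟨x, rfl⟩
      rw [hT, inner_add_right, inner_smul_right] at this
      rw [inner_smul_left, map_neg, Complex.conj_ofReal]
      linear_combination -this
    have hd : y ∈ H.adjoint.domain := LinearPMap.mem_adjoint_domain_of_exists y ⟨_, hadj⟩
    have hval : H.adjoint ⟨y, hd⟩ = -(α : ℂ) • y :=
      LinearPMap.adjoint_apply_eq hsa.dense_domain _ hadj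
    have key : ∀ K : E →ₗ.[ℂ] E, K = H → ∀ h : y ∈ K.domain, K ⟨y, h⟩ = -(α : ℂ) • y →
        y = 0 := by
      rintro K rfl h hK
      have h1 := hb ⟨y, h⟩
      rw [hK] at h1
      simp only [neg_smul, neg_add_cancel, norm_zero] at h1
      by_contra hc
      have := norm_pos_iff.mpr hc
      nlinarith [mul_pos hα this]
    exact key _ (LinearPMap.isSelfAdjoint_def.mp hsa) hd hval
  let e := LinearEquiv.ofBijective T ⟨hinj, LinearMap.range_eq_top.mp hsurj⟩
  have he : ∀ x, e x = T x := fun x => rfl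
  refine ⟨(H.domain.subtype ∘ₗ (e.symm : E →ₗ[ℂ] H.domain)).mkContinuous α⁻¹ ?_, ?_, ?_⟩
  · intro x
    have h1 := hb (e.symm x)
    rw [← hT, ← he, e.apply_symm_apply] at h1
    change ‖(e.symm x : E)‖ ≤ _
    rw [inv_mul_eq_div, le_div_iff₀ hα]
    linarith
  · intro x
    refine ⟨(e.symm x).2, ?_⟩
    have := e.apply_symm_apply x
    rw [he, hT] at this
    change H (e.symm x) - -(α : ℂ) • (e.symm x : E) = x
    rw [neg_smul, sub_neg_eq_add]
    exact this
  · intro x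
    change (e.symm (H x - -(α : ℂ) • (x : E)) : E) = x
    rw [neg_smul, sub_neg_eq_add, ← hT, ← he, e.symm_apply_apply]

theorem isResolventAt_shiftInv [CompleteSpace E] {H : E →ₗ.[ℂ] E} (hsa : IsSelfAdjoint H)
    (hH : Nonnegative H) {α : ℝ} (hα : 0 < α) :
    IsResolventAt H (-(α : ℂ)) (shiftInv H α) := by
  have h := exists_isResolventAt_neg hsa hH hα
  rw [shiftInv, dif_pos h]
  exact h.choose_spec

end

end WeylCriterion

/-! Put `R = (H + α)⁻¹`, `β = lam + α` and `T = 1 - β R`, a bounded self-adjoint operator. Since `R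
(H - lam) ψ = T ψ`, the pairings for `m = 1, 2` are `(ψ, T ψ)` and `(R ψ, T ψ)`, so `‖T ψ‖²` is the
first minus `β` times the second (`norm_sq_eq_weylPairing`). Condition 2 thus says exactly that `T
ψ_j → 0`.

The Möbius map `z ↦ 1 - β / (z + α)` sends `lam` to `0` and matches `σ(H)` with `σ(T)`, cluster
points included; the eigenspace at `lam` is `ker T`. Hence (a) and (b) reduce to Weyl's criterion
for `T` at `0`, which rests on one equivalence: `0` is not a cluster point of `σ(T)` iff `T` is
bounded below on `(ker T)ᗮ`. Approximate null vectors of `T` enter `Dom(H)` by applying `R` and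
normalizing.

For (c), a residual `‖T ψ‖ ≤ s ≤ 1/2` gives a point of `σ(T)` of modulus at most `s`, hence a point
of `σ(H)` within `2 β s` of `lam`, where `s² ≤ (1 + β) δ`. If `δ` is too large for this, the first
pairing alone bounds `‖R‖` below and places a spectral point at bounded distance. -/

namespace WeylCriterion

/-! ### Weyl's criterion at `0` for bounded self-adjoint operators. -/

section BoundedOperators

open ContinuousLinearMap

variable {E : Type*} [NormedAddCommGroup E] [InnerProductSpace ℂ E]

/-- Weak convergence to zero, tested by inner products. -/
theorem tendsto_toWeakSpace_zero_iff [CompleteSpace E] {ι : Type*} {l : Filter ι} {x : ι → E} :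
    Tendsto (fun j => toWeakSpace ℂ E (x j)) l (𝓝 0) ↔
      ∀ y : E, Tendsto (fun j => inner ℂ y (x j)) l (𝓝 0) := by
  have h := WeakBilin.tendsto_iff_forall_eval_tendsto (B := (topDualPairing ℂ E).flip) (l := l)
    (f := fun j => toWeakSpace ℂ E (x j)) (x := (0 : WeakSpace ℂ E))
    (fun a b hab => by
      by_contra hne
      obtain ⟨f, hf⟩ := SeparatingDual.exists_separating_of_ne (R := ℂ) hne
      exact hf (LinearMap.congr_fun hab f))
  refine Iff.trans h ⟨fun h y => ?_, fun h f => ?_⟩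
  · have : Tendsto (fun j => inner ℂ y (x j)) l (𝓝 (InnerProductSpace.toDual ℂ E y 0)) :=
      h (InnerProductSpace.toDual ℂ E y)
    rwa [map_zero] at this
  · have := h ((InnerProductSpace.toDual ℂ E).symm f)
    simp only [InnerProductSpace.toDual_symm_apply] at this
    rw [← map_zero f] at this
    exact this

theorem tendsto_inner_of_orthonormal {v : ℕ → E} (hv : Orthonormal ℂ v) (y : E) :
    Tendsto (fun n => inner ℂ y (v n)) atTop (𝓝 0) := by
  have h := (hv.inner_products_summable (x := y)).tendsto_atTop_zero
  rw [tendsto_zero_iff_norm_tendsto_zero]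
  have h2 := h.sqrt
  simpa [Real.sqrt_sq, norm_inner_symm y] using h2

theorem exists_orthonormal_of_not_finiteDimensional {K : Submodule ℂ E}
    (hK : ¬ FiniteDimensional ℂ K) : ∃ v : ℕ → E, Orthonormal ℂ v ∧ ∀ n, v n ∈ K := by
  let b := Module.Basis.ofVectorSpace ℂ K
  have : Infinite (Module.Basis.ofVectorSpaceIndex ℂ K) := by
    by_contra hfin
    rw [not_infinite_iff_finite] at hfin
    exact hK (Module.Finite.of_basis b)
  let f : ℕ → K := fun n => b (Infinite.natEmbedding _ n)
  have hf : LinearIndependent ℂ f :=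
    b.linearIndependent.comp _ (Infinite.natEmbedding _).injective
  have ho := InnerProductSpace.gramSchmidtNormed_orthonormal hf
  exact ⟨_, ho.comp_linearIsometry K.subtypeₗᵢ, fun n => Subtype.property _⟩

/-- A normalized sequence along which a bound from below fails. -/
theorem exists_unit_seq_tendsto_zero {F : Type*} [NormedAddCommGroup F] [NormedSpace ℂ F]
    {T : E →L[ℂ] F} {K : Submodule ℂ E}
    (h : ¬ ∃ c > 0, ∀ x ∈ K, c * ‖x‖ ≤ ‖T x‖) :
    ∃ φ : ℕ → E, (∀ n, φ n ∈ K) ∧ (∀ n, ‖φ n‖ = 1) ∧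
      Tendsto (fun n => T (φ n)) atTop (𝓝 0) := by
  push Not at h
  have h1 : ∀ n : ℕ, ∃ x ∈ K, ‖x‖ = 1 ∧ ‖T x‖ ≤ 1 / ((n : ℝ) + 1) := by
    intro n
    obtain ⟨x, hxK, hx⟩ := h (1 / ((n : ℝ) + 1)) (by positivity)
    have hx0 : ‖x‖ ≠ 0 := by
      intro h0
      rw [h0, mul_zero] at hx
      exact absurd hx (not_lt.mpr (norm_nonneg _))
    refine ⟨(‖x‖⁻¹ : ℂ) • x, K.smul_mem _ hxK, ?_, ?_⟩
    · rw [norm_smul, norm_inv, Complex.norm_real, norm_norm, inv_mul_cancel₀ hx0]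
    · rw [map_smul, norm_smul, norm_inv, Complex.norm_real, norm_norm, inv_mul_eq_div,
        div_le_iff₀ (lt_of_le_of_ne (norm_nonneg _) hx0.symm)]
      exact hx.le
  choose φ hK hn hT using h1
  exact ⟨φ, hK, hn, squeeze_zero_norm hT tendsto_one_div_add_atTop_nhds_zero_nat⟩

variable [CompleteSpace E]

/-- For normal `T` the complement of the range is `ker T`, which the lower bound makes trivial.
Normality, not self-adjointness, is needed because `k - T` with complex `k` occurs below. -/
theorem isUnit_of_isStarNormal_of_le_norm {T : E →L[ℂ] E} (hT : IsStarNormal T) {c : ℝ}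
    (hc : 0 < c) (h : ∀ x, c * ‖x‖ ≤ ‖T x‖) : IsUnit T := by
  rw [isUnit_iff_bijective, bijective_iff_dense_range_and_antilipschitz]
  refine ⟨?_, antilipschitzWith_iff_exists_mul_le_norm.mpr ⟨c, hc, h⟩⟩
  rw [Submodule.topologicalClosure_eq_top_iff, IsStarNormal.orthogonal_range hT,
    Submodule.eq_bot_iff]
  intro x hx
  have h1 := h x
  have h0 : T x = 0 := hx
  rw [h0, norm_zero] at h1
  exact norm_le_zero_iff.mp (by nlinarith)

theorem exists_le_norm_of_isUnit {T : E →L[ℂ] E} (hT : IsUnit T) :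
    ∃ c > 0, ∀ x, c * ‖x‖ ≤ ‖T x‖ :=
  antilipschitzWith_iff_exists_mul_le_norm.mp
    (bijective_iff_dense_range_and_antilipschitz T |>.mp (isUnit_iff_bijective.mp hT)).2

theorem not_isUnit_of_tendsto {T : E →L[ℂ] E} {φ : ℕ → E} (hφ : ∀ n, ‖φ n‖ = 1)
    (hT : Tendsto (fun n => T (φ n)) atTop (𝓝 0)) : ¬ IsUnit T := by
  intro hu
  obtain ⟨c, hc, h⟩ := exists_le_norm_of_isUnit hu
  have h1 : Tendsto (fun n => ‖T (φ n)‖) atTop (𝓝 0) := by simpa using hT.norm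
  have h2 : c ≤ 0 := ge_of_tendsto' h1 fun n => by simpa [hφ] using h (φ n)
  linarith

theorem exists_mem_spectrum_norm_eq [Nontrivial E] {A : E →L[ℂ] E} (hA : IsSelfAdjoint A) :
    ∃ k ∈ _root_.spectrum ℂ A, ‖k‖ = ‖A‖ := by
  obtain ⟨k, hk, h⟩ := spectrum.exists_nnnorm_eq_spectralRadius A
  refine ⟨k, hk, ?_⟩
  rw [hA.spectralRadius_eq_nnnorm] at h
  exact congrArg NNReal.toReal (ENNReal.coe_injective h)

/-- An approximate null vector of a self-adjoint operator yields a spectral point near `0`. -/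
theorem exists_mem_spectrum_norm_le {T : E →L[ℂ] E} (hT : IsSelfAdjoint T) {ψ : E}
    (hψ : ‖ψ‖ = 1) : ∃ k ∈ _root_.spectrum ℂ T, ‖k‖ ≤ ‖T ψ‖ := by
  have : Nontrivial E := ⟨ψ, 0, fun h => by simp [h] at hψ⟩
  by_cases hu : IsUnit T
  · obtain ⟨U, rfl⟩ := hu
    have hU : IsSelfAdjoint (↑U⁻¹ : E →L[ℂ] E) := by
      have h1 : star U = U := Units.ext hT
      have h2 : star U⁻¹ = U⁻¹ := by rw [star_inv, h1]
      exact congrArg Units.val h2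
    obtain ⟨k, hk, hkn⟩ := exists_mem_spectrum_norm_eq hU
    have hk0 : k ≠ 0 := spectrum.ne_zero_of_mem_of_unit hk
    refine ⟨k⁻¹, ?_, ?_⟩
    · have := (spectrum.inv_mem_iff (r := Units.mk0 k hk0) (a := U⁻¹)).mp hk
      simpa using this
    · have h1 : (1 : ℝ) ≤ ‖k‖ * ‖(U : E →L[ℂ] E) ψ‖ := by
        rw [hkn, ← hψ]
        have h2 := (↑U⁻¹ : E →L[ℂ] E).le_opNorm ((U : E →L[ℂ] E) ψ)
        have h3 : (↑U⁻¹ : E →L[ℂ] E) ((U : E →L[ℂ] E) ψ) = ψ := by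
          rw [← mul_apply_eq_comp, Units.inv_mul]; rfl
        rwa [h3] at h2
      rw [norm_inv, inv_le_iff_one_le_mul₀ (norm_pos_iff.mpr hk0)]
      linarith
  · exact ⟨0, spectrum.zero_mem_iff ℂ |>.mpr hu, by simp⟩

/-- Approximate null vectors of `T` orthogonal to `ker T` are weakly null. -/
theorem tendsto_inner_of_mem_orthogonal_ker {T : E →L[ℂ] E} (hT : IsSelfAdjoint T)
    {φ : ℕ → E} (hK : ∀ n, φ n ∈ T.kerᗮ) (hn : ∀ n, ‖φ n‖ = 1)
    (h : Tendsto (fun n => T (φ n)) atTop (𝓝 0)) (y : E) :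
    Tendsto (fun n => inner ℂ y (φ n)) atTop (𝓝 0) := by
  have hadj : adjoint T = T := hT
  have hdense : ∀ z ∈ T.kerᗮ, Tendsto (fun n => inner ℂ z (φ n)) atTop (𝓝 0) := by
    intro z hz
    rw [orthogonal_ker, hadj] at hz
    rw [Metric.tendsto_atTop]
    intro ε hε
    -- `(ker T)ᗮ` is the closure of the range; on a vector `T w` the pairing equals `(w, T φ_n) →
    -- 0`.
    obtain ⟨_, ⟨w, rfl⟩, hw⟩ := Metric.mem_closure_iff.mp hz (ε / 2) (by positivity)
    have h1 : Tendsto (fun n => inner ℂ w (T (φ n))) atTop (𝓝 0) := by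
      simpa using (tendsto_const_nhds (x := w)).inner h (𝕜 := ℂ)
    obtain ⟨N, hN⟩ := Metric.tendsto_atTop.mp h1 (ε / 2) (by positivity)
    refine ⟨N, fun n hnN => ?_⟩
    have h2 := hN n hnN
    rw [dist_zero_right] at h2 ⊢
    have h3 : inner ℂ z (φ n) = inner ℂ (z - T w) (φ n) + inner ℂ w (T (φ n)) := by
      rw [inner_sub_left, ← adjoint_inner_left, hadj]; ring
    have h4 : ‖inner ℂ (z - T w) (φ n)‖ ≤ ‖z - T w‖ := by
      have := norm_inner_le_norm (𝕜 := ℂ) (z - T w) (φ n)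
      rwa [hn, mul_one] at this
    rw [dist_eq_norm] at hw
    have hw' : ‖z - T w‖ < ε / 2 := hw
    rw [h3]
    exact (norm_add_le _ _).trans_lt (by linarith)
  obtain ⟨k, hk, z, hz, rfl⟩ := T.ker.exists_add_mem_mem_orthogonal y
  have : ∀ n, inner ℂ (k + z) (φ n) = inner ℂ z (φ n) := fun n => by
    rw [inner_add_left, (Submodule.mem_orthogonal _ _).mp (hK n) k hk, zero_add]
  simpa only [this] using hdense z hz

/-- If `T` is bounded below on `(ker T)ᗮ`, then `0` is not a cluster point of its spectrum. -/
theorem not_accPt_of_le_norm {T : E →L[ℂ] E} (hT : IsSelfAdjoint T) {c : ℝ} (hc : 0 < c)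
    (h : ∀ x ∈ T.kerᗮ, c * ‖x‖ ≤ ‖T x‖) : ¬ AccPt 0 (𝓟 (_root_.spectrum ℂ T)) := by
  have hadj : adjoint T = T := hT
  rw [accPt_iff_frequently, not_frequently]
  filter_upwards [Metric.ball_mem_nhds (0 : ℂ) hc] with k hk
  rintro ⟨hk0, hks⟩
  rw [mem_ball_zero_iff] at hk
  have hkpos := norm_pos_iff.mpr hk0
  refine hks ?_
  have hnormal : IsStarNormal (algebraMap ℂ (E →L[ℂ] E) k - T) := by
    rw [isStarNormal_iff, star_sub, hT.star_eq, ← algebraMap_star_comm]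
    exact ((Algebra.commute_algebraMap_left _ _).sub_right
      (Algebra.commute_algebraMap_left _ _)).sub_left ((Algebra.commute_algebraMap_right _ _).sub_right (Commute.refl _))
  -- `k - T` is bounded below by `‖k‖` on `ker T` and by `c - ‖k‖` on the invariant complement;
  -- Pythagoras combines the two.
  set d := min ‖k‖ (c - ‖k‖) with hd
  have hdpos : 0 < d := lt_min hkpos (by linarith)
  refine isUnit_of_isStarNormal_of_le_norm hnormal hdpos fun x => ?_
  obtain ⟨y, hy, z, hz, rfl⟩ := T.ker.exists_add_mem_mem_orthogonal x
  have hTy : T y = 0 := hy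
  have hTz : T z ∈ T.kerᗮ := by
    rw [orthogonal_ker, hadj]
    exact Submodule.le_topologicalClosure _ ⟨z, rfl⟩
  have e1 : (algebraMap ℂ (E →L[ℂ] E) k - T) (y + z) = k • y + (k • z - T z) := by
    simp [Algebra.algebraMap_eq_smul_one, hTy, add_sub_assoc]
  have o1 : inner ℂ y z = 0 := hz y hy
  have o2 : inner ℂ (k • y) (k • z - T z) = 0 :=
    (T.kerᗮ.sub_mem (T.kerᗮ.smul_mem k hz) hTz) _ (T.ker.smul_mem k hy)
  have p1 := norm_add_sq_eq_norm_sq_add_norm_sq_of_inner_eq_zero y z o1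
  have p2 := norm_add_sq_eq_norm_sq_add_norm_sq_of_inner_eq_zero _ _ o2
  have b1 : d * ‖y‖ ≤ ‖k • y‖ := by
    rw [norm_smul]; gcongr; exact min_le_left _ _
  have b2 : d * ‖z‖ ≤ ‖k • z - T z‖ := by
    have := norm_sub_norm_le (T z) (k • z)
    rw [norm_sub_rev, norm_smul] at this
    have h1 := h z hz
    have h2 : d * ‖z‖ ≤ (c - ‖k‖) * ‖z‖ := by gcongr; exact min_le_right _ _
    linarith
  rw [e1]
  refine abs_le_of_sq_le_sq' ?_ (norm_nonneg _) |>.2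
  have q1 := mul_self_le_mul_self (by positivity) b1
  have q2 := mul_self_le_mul_self (by positivity) b2
  have q3 : (d * ‖y + z‖) ^ 2 = d * ‖y‖ * (d * ‖y‖) + d * ‖z‖ * (d * ‖z‖) := by
    linear_combination d ^ 2 * p1
  rw [q3, sq, p2]
  linarith

/-- If `0` is not a cluster point of the spectrum, then `T` is bounded below on `(ker T)ᗮ`. -/
theorem exists_le_norm_of_not_accPt {T : E →L[ℂ] E} (hT : IsSelfAdjoint T)
    (h : ¬ AccPt 0 (𝓟 (_root_.spectrum ℂ T))) :
    ∃ c > 0, ∀ x ∈ T.kerᗮ, c * ‖x‖ ≤ ‖T x‖ := by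
  have hnormal : IsStarNormal T := hT.isStarNormal
  -- With `0⁻¹ = 0`, inversion is continuous on the spectrum because `0` is not a cluster point of
  -- it. The functional calculus then yields a pseudo-inverse `G` with `T G T = T`.
  have hcont : ContinuousOn (fun z : ℂ => z⁻¹) (_root_.spectrum ℂ T) := by
    intro z hz
    rcases eq_or_ne z 0 with rfl | hz0
    · rw [← continuousWithinAt_sdiff_self]
      have : 𝓝[_root_.spectrum ℂ T \ {0}] (0 : ℂ) = ⊥ := by
        rw [accPt_iff_frequently, not_frequently] at h
        rw [← empty_mem_iff_bot, mem_nhdsWithin_iff_eventually]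
        filter_upwards [h] with y hy hy'
        exact hy ⟨hy'.2, hy'.1⟩
      rw [ContinuousWithinAt, this]
      exact tendsto_bot
    · exact (continuousAt_inv₀ hz0).continuousWithinAt
  set G := cfc (fun z : ℂ => z⁻¹) T with hG
  have hTGT : T * (G * T) = T := by
    conv_rhs => rw [← cfc_id' ℂ T]
    conv_lhs => rw [← cfc_id' ℂ T, hG, ← cfc_mul _ _ T, ← cfc_mul _ _ T]
    refine cfc_congr fun z _ => ?_
    rcases eq_or_ne z 0 with rfl | hz0
    · simp
    · simp [hz0]
  refine ⟨(‖G‖ + 1)⁻¹, by positivity, fun y hy => ?_⟩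
  -- As `y ⊥ ker T`, this gives `‖y‖² = (y, G T y)`, hence `‖y‖ ≤ ‖G‖ ‖T y‖`.
  have hmem : G (T y) - y ∈ T.ker := by
    have := congrArg (fun A : E →L[ℂ] E => A y) hTGT
    simp only [mul_apply_eq_comp] at this
    rw [LinearMap.mem_ker]
    simp [this]
  have h1 := (Submodule.mem_orthogonal' _ _).mp hy _ hmem
  rw [inner_sub_right, sub_eq_zero] at h1
  have h2 : ‖y‖ * ‖y‖ ≤ ‖y‖ * ‖G (T y)‖ := by
    have := norm_inner_le_norm (𝕜 := ℂ) y (G (T y))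
    rw [h1, inner_self_eq_norm_sq_to_K, norm_pow] at this
    simpa [sq] using this
  have h3 := G.le_opNorm (T y)
  rw [inv_mul_le_iff₀ (by positivity)]
  rcases eq_or_ne y 0 with rfl | hy0
  · simp
  · have := le_of_mul_le_mul_left h2 (norm_pos_iff.mpr hy0)
    nlinarith [norm_nonneg (T y)]

/-- Weyl's criterion for a bounded self-adjoint operator at the point `0`. -/
theorem exists_weaklyNull_seq {T : E →L[ℂ] E} (hT : IsSelfAdjoint T)
    (h : AccPt 0 (𝓟 (_root_.spectrum ℂ T)) ∨ ¬ FiniteDimensional ℂ T.ker) :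
    ∃ φ : ℕ → E, (∀ n, ‖φ n‖ = 1) ∧ Tendsto (fun n => T (φ n)) atTop (𝓝 0) ∧
      ∀ y, Tendsto (fun n => inner ℂ y (φ n)) atTop (𝓝 0) := by
  rcases h with h | h
  · obtain ⟨φ, hK, hn, hφ⟩ := exists_unit_seq_tendsto_zero (T := T) (K := T.kerᗮ) (by
      rintro ⟨c, hc, hle⟩
      exact not_accPt_of_le_norm hT hc hle h)
    exact ⟨φ, hn, hφ, tendsto_inner_of_mem_orthogonal_ker hT hK hn hφ⟩
  · obtain ⟨v, hv, hvK⟩ := exists_orthonormal_of_not_finiteDimensional h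
    refine ⟨v, hv.1, ?_, tendsto_inner_of_orthonormal hv⟩
    have : ∀ n, T (v n) = 0 := fun n => hvK n
    simp [this]

/-- If both alternatives failed, the part of `φ n` in `(ker T)ᗮ` would vanish by the lower bound,
and the part in the finite-dimensional kernel because weak convergence is norm convergence there.
This contradicts `‖φ n‖ = 1`. -/
theorem accPt_or_not_finiteDimensional_of_weaklyNull_seq {T : E →L[ℂ] E}
    (hT : IsSelfAdjoint T) {φ : ℕ → E} (hn : ∀ n, ‖φ n‖ = 1)
    (hφ : Tendsto (fun n => T (φ n)) atTop (𝓝 0))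
    (hw : ∀ y, Tendsto (fun n => inner ℂ y (φ n)) atTop (𝓝 0)) :
    AccPt 0 (𝓟 (_root_.spectrum ℂ T)) ∨ ¬ FiniteDimensional ℂ T.ker := by
  by_contra! hcon
  obtain ⟨hacc, hfin⟩ := hcon
  obtain ⟨c, hc, hle⟩ := exists_le_norm_of_not_accPt hT hacc
  let P := T.ker.starProjection
  have hmem : ∀ n, φ n - P (φ n) ∈ T.kerᗮ := fun n =>
    T.ker.sub_starProjection_mem_orthogonal _
  have hTP : ∀ n, T (φ n - P (φ n)) = T (φ n) := fun n => by
    have : T (P (φ n)) = 0 := T.ker.starProjection_apply_mem _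
    rw [map_sub, this, sub_zero]
  have h1 : Tendsto (fun n => φ n - P (φ n)) atTop (𝓝 0) := by
    refine squeeze_zero_norm (a := fun n => c⁻¹ * ‖T (φ n)‖) (fun n => ?_) ?_
    · have := hle _ (hmem n)
      rw [hTP] at this
      rw [inv_mul_eq_div, le_div_iff₀ hc]
      linarith
    · simpa using (hφ.norm.const_mul c⁻¹)
  have h2 : Tendsto (fun n => P (φ n)) atTop (𝓝 0) := by
    let b := stdOrthonormalBasis ℂ T.ker
    have hP : ∀ x, P x = ∑ i, inner ℂ (b i : E) x • (b i : E) := fun x => by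
      have := b.sum_repr (T.ker.orthogonalProjectionOnto x)
      have h3 := congrArg (fun w : T.ker => (w : E)) this
      simp only [Submodule.coe_sum, Submodule.coe_smul, b.repr_apply_apply,
        Submodule.inner_orthogonalProjectionOnto_eq_of_mem_left] at h3
      exact h3.symm
    simp only [hP]
    rw [← Finset.sum_const_zero (s := (Finset.univ : Finset (Fin (Module.finrank ℂ T.ker))))]
    refine tendsto_finsetSum _ fun i _ => ?_
    simpa using (hw (b i)).smul_const (b i : E)
  have h3 : Tendsto (fun n => ‖φ n‖) atTop (𝓝 0) := by
    simpa using (h1.add h2).norm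
  simp only [hn] at h3
  exact one_ne_zero (tendsto_nhds_unique tendsto_const_nhds h3)

end BoundedOperators

/-! ### Passage from `H` to its resolvent. -/

section Transfer

variable {E : Type*} [NormedAddCommGroup E] [InnerProductSpace ℂ E]
  {H : E →ₗ.[ℂ] E} {R : E →L[ℂ] E} {α : ℝ}

theorem IsResolventAt.apply_eq (hR : IsResolventAt H (-(α : ℂ)) R) (x : E)
    (h : R x ∈ H.domain) : H ⟨R x, h⟩ = x - (α : ℂ) • R x := by
  obtain ⟨_, hx⟩ := hR.1 x
  rw [neg_smul, sub_neg_eq_add] at hx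
  exact eq_sub_of_add_eq hx

theorem IsResolventAt.apply_sub (hR : IsResolventAt H (-(α : ℂ)) R) (z : ℂ) (x : H.domain) :
    R (H x - z • (x : E)) = (1 - (z + α) • R) (x : E) := by
  have h := hR.2 x
  simp only [neg_smul, sub_neg_eq_add, map_add, map_smul] at h
  rw [map_sub, map_smul, sub_apply, one_apply_eq_self, smul_apply, add_smul]
  rw [← eq_sub_iff_add_eq] at h
  rw [h]
  abel

/-- `z ∈ σ(H)` in terms of the bounded operator `R = (H + α)⁻¹`. -/
theorem IsResolventAt.mem_spectrum_iff (hR : IsResolventAt H (-(α : ℂ)) R) (z : ℂ) :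
    z ∈ spectrum H ↔ ¬ IsUnit (1 - (z + α) • R) := by
  rw [spectrum, Set.mem_ofPred_eq, not_iff_not]
  constructor
  · rintro ⟨S, hS⟩
    have hSR : ∀ x, S ((1 - (z + α) • R) x) = R x := fun x => by
      obtain ⟨h, -⟩ := hR.1 x
      have h1 := hS.2 ⟨R x, h⟩
      rw [hR.apply_eq] at h1
      refine Eq.trans (congrArg S ?_) h1
      rw [sub_apply, one_apply_eq_self, smul_apply, add_smul]
      abel
    have hRS : ∀ x, (1 - (z + α) • R) (S x) = R x := fun x => by
      obtain ⟨h, hx⟩ := hS.1 x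
      rw [← hR.apply_sub z ⟨S x, h⟩, hx]
    -- Formally `1 - (z + α) R = (H - z) R`, whose inverse is `(H + α) S = 1 + (z + α) S`.
    refine ⟨⟨1 - (z + α) • R, 1 + (z + α) • S, ?_, ?_⟩, rfl⟩ <;> ext x
    · have := hRS x
      rw [mul_add, mul_one, mul_smul_comm]
      simp [-map_sub] at this ⊢
      simp [this]
    · have := hSR x
      rw [add_mul, one_mul, smul_mul_assoc]
      simp [-map_sub] at this ⊢
      simp [this]
  · rintro ⟨U, hU⟩
    have hcomm : Commute (↑U : E →L[ℂ] E) R := by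
      rw [hU]
      exact (Commute.one_left R).sub_left ((Commute.refl R).smul_left _)
    have hcomm' : Commute (↑U⁻¹ : E →L[ℂ] E) R := hcomm.units_inv_left
    refine ⟨R * ↑U⁻¹, fun x => ?_, fun x => ?_⟩
    · obtain ⟨h, -⟩ := hR.1 ((↑U⁻¹ : E →L[ℂ] E) x)
      refine ⟨h, ?_⟩
      have h1 : (U : E →L[ℂ] E) ((↑U⁻¹ : E →L[ℂ] E) x) = x := by
        rw [← mul_apply_eq_comp, Units.mul_inv]; rfl
      change H ⟨R ((↑U⁻¹ : E →L[ℂ] E) x), h⟩ - z • R ((↑U⁻¹ : E →L[ℂ] E) x) = x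
      rw [hR.apply_eq]
      nth_rw 4 [← h1]
      rw [hU]
      simp [add_smul]
      abel
    · rw [← hcomm'.eq, mul_apply_eq_comp, hR.apply_sub, ← hU,
        ← mul_apply_eq_comp, Units.inv_mul]
      rfl

/-- The Möbius map `(z + α) (1 - k) = β` carries `σ(H)` to the spectrum of `1 - β (H + α)⁻¹`. -/
theorem IsResolventAt.mem_spectrum_iff_mem (hR : IsResolventAt H (-(α : ℂ)) R) {z k β : ℂ}
    (hβ : β ≠ 0) (h : (z + α) * (1 - k) = β) :
    z ∈ spectrum H ↔ k ∈ _root_.spectrum ℂ (1 - β • R) := by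
  have hk : -(1 - k) ≠ 0 := by
    rw [neg_ne_zero]
    rintro h0
    rw [h0, mul_zero] at h
    exact hβ h.symm
  have e : algebraMap ℂ (E →L[ℂ] E) k - (1 - β • R)
      = Units.mk0 _ hk • (1 - (z + α) • R) := by
    rw [Units.smul_mk0, Algebra.algebraMap_eq_smul_one, ← h, smul_sub, smul_smul, neg_smul,
      sub_smul, one_smul, mul_comm, neg_mul, neg_smul]
    abel
  rw [hR.mem_spectrum_iff, _root_.spectrum.mem_iff, e, isUnit_smul_iff]

/-- The Möbius map and its inverse `k ↦ β / (1 - k) - α` carry punctured neighbourhoods of `lam` and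
`0` into each other; as `β ≠ 0`, both poles stay away from these points. -/
theorem IsResolventAt.accPt_iff (hR : IsResolventAt H (-(α : ℂ)) R) {lam β : ℂ}
    (hβ : β ≠ 0) (h : lam + α = β) :
    AccPt lam (𝓟 (spectrum H)) ↔ AccPt 0 (𝓟 (_root_.spectrum ℂ (1 - β • R))) := by
  simp only [accPt_iff_frequently_nhdsNE]
  constructor
  · intro hf
    have ht : Tendsto (fun z : ℂ => 1 - β / (z + α)) (𝓝[≠] lam) (𝓝[≠] 0) := by
      refine tendsto_nhdsWithin_iff.mpr ⟨?_, ?_⟩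
      · have : ContinuousAt (fun z : ℂ => 1 - β / (z + α)) lam :=
          continuousAt_const.sub (continuousAt_const.div
            (continuousAt_id.add continuousAt_const) (by simpa [h] using hβ))
        have h2 := this.tendsto
        simp only [h, div_self hβ, sub_self] at h2
        exact h2.mono_left nhdsWithin_le_nhds
      · filter_upwards [self_mem_nhdsWithin] with z hz h0
        rw [Set.mem_singleton_iff, sub_eq_zero, eq_comm, div_eq_one_iff_eq] at h0
        · exact hz (show z = lam by linear_combination -h - h0)
        · intro h1; rw [h1, div_zero] at h0; exact zero_ne_one h0
    have hne : ∀ᶠ z : ℂ in 𝓝[≠] lam, z + α ≠ 0 := by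
      refine Filter.Eventually.filter_mono nhdsWithin_le_nhds ?_
      exact (continuousAt_id.add continuousAt_const).eventually_ne (by simpa [h] using hβ)
    refine ht.frequently ((hf.and_eventually hne).mono ?_)
    rintro z ⟨hz, hz0⟩
    exact (hR.mem_spectrum_iff_mem hβ (by field_simp; ring)).mp hz
  · intro hf
    have ht : Tendsto (fun k : ℂ => β / (1 - k) - α) (𝓝[≠] 0) (𝓝[≠] lam) := by
      refine tendsto_nhdsWithin_iff.mpr ⟨?_, ?_⟩
      · have : ContinuousAt (fun k : ℂ => β / (1 - k) - α) 0 :=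
          (continuousAt_const.div (continuousAt_const.sub continuousAt_id) (by simp)).sub
            continuousAt_const
        have h2 := this.tendsto
        simp only [sub_zero, div_one, ← h, add_sub_cancel_right] at h2
        rw [← h]
        exact h2.mono_left nhdsWithin_le_nhds
      · filter_upwards [self_mem_nhdsWithin] with k hk h0
        rw [Set.mem_singleton_iff] at h0
        have h1 : β / (1 - k) = β := by linear_combination h + h0
        have h2 : 1 - k ≠ 0 := by
          intro h2; rw [h2, div_zero] at h1; exact hβ h1.symm
        rw [div_eq_iff h2] at h1
        have h3 : β * k = 0 := by linear_combination h1
        exact hk ((mul_eq_zero.mp h3).resolve_left hβ)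
    have hne : ∀ᶠ k : ℂ in 𝓝[≠] 0, 1 - k ≠ 0 := by
      refine Filter.Eventually.filter_mono nhdsWithin_le_nhds ?_
      exact (continuousAt_const.sub continuousAt_id).eventually_ne (by simp)
    refine ht.frequently ((hf.and_eventually hne).mono ?_)
    rintro k ⟨hk, hk0⟩
    exact (hR.mem_spectrum_iff_mem hβ (by field_simp; ring)).mpr hk

theorem IsResolventAt.eigenspace_eq (hR : IsResolventAt H (-(α : ℂ)) R) {lam β : ℂ}
    (h : lam + α = β) : eigenspace H lam = (1 - β • R).ker := by
  ext x
  rw [mem_eigenspace]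
  constructor
  · rintro ⟨hx, hHx⟩
    have := hR.apply_sub lam ⟨x, hx⟩
    rw [hHx, sub_self, map_zero, h] at this
    exact this.symm
  · intro hx
    have hx' : x = β • R x := sub_eq_zero.mp hx
    obtain ⟨hd, -⟩ := hR.1 x
    have hxd : x ∈ H.domain := by rw [hx']; exact H.domain.smul_mem _ hd
    refine ⟨hxd, ?_⟩
    have e : (⟨x, hxd⟩ : H.domain) = β • ⟨R x, hd⟩ := Subtype.ext hx'
    rw [e, H.map_smul, hR.apply_eq, smul_sub, smul_comm, ← hx', ← sub_smul, ← h,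
      add_sub_cancel_right]

variable [CompleteSpace E]

theorem IsResolventAt.isSelfAdjoint (hR : IsResolventAt H (-(α : ℂ)) R) (hsa : IsSelfAdjoint H) :
    IsSelfAdjoint R := by
  have hform : H.IsFormalAdjoint H := by
    have := LinearPMap.adjoint_isFormalAdjoint hsa.dense_domain
    rwa [LinearPMap.isSelfAdjoint_def.mp hsa] at this
  rw [ContinuousLinearMap.isSelfAdjoint_iff_isSymmetric]
  intro x y
  obtain ⟨hx, -⟩ := hR.1 x
  obtain ⟨hy, -⟩ := hR.1 y
  have h := hform ⟨R x, hx⟩ ⟨R y, hy⟩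
  rw [hR.apply_eq, hR.apply_eq, inner_sub_left, inner_sub_right, inner_smul_left,
    inner_smul_right, Complex.conj_ofReal] at h
  change inner ℂ (R x) y = inner ℂ x (R y)
  simp only at h
  linear_combination -h

theorem isSelfAdjoint_one_sub_smul (hR : IsSelfAdjoint R) (β : ℝ) :
    IsSelfAdjoint (1 - (β : ℂ) • R) := by
  refine (IsSelfAdjoint.one _).sub ?_
  rw [isSelfAdjoint_iff, star_smul, hR.star_eq]
  simp

/-- One factor of the self-adjoint resolvent moves to the second slot and absorbs `H - lam`, so no
unbounded operator remains. -/
theorem weylPairing_succ (hα : 0 < α) (hsa : IsSelfAdjoint H) (hH : Nonnegative H) (lam : ℝ)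
    (m : ℕ) (ψ : H.domain) :
    weylPairing H α lam (m + 1) ψ = inner ℂ ((shiftInv H α ^ m) (ψ : E))
      ((1 - ((lam + α : ℝ) : ℂ) • shiftInv H α) (ψ : E)) := by
  have hR := isResolventAt_shiftInv hsa hH hα
  have hs : (shiftInv H α).adjoint = shiftInv H α := hR.isSelfAdjoint hsa
  rw [weylPairing, pow_succ', mul_apply_eq_comp, Complex.ofReal_add,
    ← hR.apply_sub, ← ContinuousLinearMap.adjoint_inner_left, hs]

/-- The two pairings control the residual of the resolvent. -/
theorem norm_sq_eq_weylPairing (hα : 0 < α) (hsa : IsSelfAdjoint H) (hH : Nonnegative H)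
    (lam : ℝ) (ψ : H.domain) :
    (((‖(1 - ((lam + α : ℝ) : ℂ) • shiftInv H α) (ψ : E)‖ ^ 2 : ℝ)) : ℂ) =
      weylPairing H α lam 1 ψ - ((lam + α : ℝ) : ℂ) * weylPairing H α lam 2 ψ := by
  rw [show (1 : ℕ) = 0 + 1 from rfl, show (2 : ℕ) = (0 + 1) + 1 from rfl,
    weylPairing_succ hα hsa hH, weylPairing_succ hα hsa hH, Complex.ofReal_pow]
  set v := (1 - ((lam + α : ℝ) : ℂ) • shiftInv H α) (ψ : E) with hv
  have h1 : ((‖v‖ : ℂ)) ^ 2 = inner ℂ v v := (inner_self_eq_norm_sq_to_K v).symm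
  rw [h1]
  nth_rw 1 [hv]
  simp only [sub_apply, smul_apply, inner_sub_left, inner_smul_left, Complex.conj_ofReal]
  simp

end Transfer

/-! ### The sequence criteria (a) and (b). -/

section Criteria

variable {E : Type*} [NormedAddCommGroup E] [InnerProductSpace ℂ E]
  {H : E →ₗ.[ℂ] E} {R : E →L[ℂ] E} {α β : ℝ}

/-- Approximate null vectors of `1 - β R` can be moved into `Dom(H)` by applying `R`. -/
theorem exists_domain_seq (hR : IsResolventAt H (-(α : ℂ)) R) (hβ : 0 < β) {φ : ℕ → E}
    (hn : ∀ n, ‖φ n‖ = 1)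
    (hφ : Tendsto (fun n => (1 - (β : ℂ) • R) (φ n)) atTop (𝓝 0)) :
    ∃ ψ : ℕ → H.domain, ∃ a : ℕ → ℂ, ∃ N : ℕ, (∀ n, ‖(ψ n : E)‖ = 1) ∧
      (∀ n, ‖a n‖ ≤ 2 * β) ∧ (∀ n, (ψ n : E) = a n • R (φ (n + N))) ∧
      Tendsto (fun n => (1 - (β : ℂ) • R) (ψ n : E)) atTop (𝓝 0) := by
  set T := 1 - (β : ℂ) • R with hT
  have hTx : ∀ x, T x = x - (β : ℂ) • R x := fun x => rfl
  have h0 : Tendsto (fun n => ‖T (φ n)‖) atTop (𝓝 0) := by simpa using hφ.norm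
  -- Once `‖T φ_n‖ < 1/2`, one has `β ‖R φ_n‖ ≥ 1/2`, so the normalizing factors are at most `2 β`.
  -- Discarding the first `N` terms makes this hold for all indices.
  obtain ⟨N, hN⟩ := eventually_atTop.mp (h0.eventually (gt_mem_nhds (show (0 : ℝ) < 1 / 2 by norm_num)))
  have hlow : ∀ n, 1 / 2 ≤ β * ‖R (φ (n + N))‖ := fun n => by
    have h1 := hN (n + N) (Nat.le_add_left _ _)
    have h2 := norm_sub_norm_le (φ (n + N)) ((β : ℂ) • R (φ (n + N)))
    rw [← hTx, hn, norm_smul, Complex.norm_real, Real.norm_of_nonneg hβ.le] at h2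
    linarith
  have hpos : ∀ n, 0 < ‖R (φ (n + N))‖ := fun n => by
    by_contra hc
    have h1 := hlow n
    have h2 : ‖R (φ (n + N))‖ = 0 := le_antisymm (not_lt.mp hc) (norm_nonneg _)
    rw [h2] at h1
    norm_num at h1
  let a : ℕ → ℂ := fun n => ((‖R (φ (n + N))‖⁻¹ : ℝ) : ℂ)
  have ha : ∀ n, ‖a n‖ = ‖R (φ (n + N))‖⁻¹ := fun n => by simp [a]
  have hale : ∀ n, ‖a n‖ ≤ 2 * β := fun n => by
    rw [ha, inv_le_iff_one_le_mul₀ (hpos n)]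
    linarith [hlow n]
  refine ⟨fun n => ⟨a n • R (φ (n + N)), H.domain.smul_mem _ (hR.1 _).1⟩, a, N, fun n => ?_,
    hale, fun n => rfl, ?_⟩
  · rw [norm_smul, ha, inv_mul_cancel₀ (hpos n).ne']
  · have hcomm : ∀ x, T (R x) = R (T x) := fun x => by
      rw [hTx, hTx, map_sub, map_smul]
    refine squeeze_zero_norm (a := fun n => 2 * β * (‖R‖ * ‖T (φ (n + N))‖)) (fun n => ?_) ?_
    · change ‖T (a n • R (φ (n + N)))‖ ≤ _
      rw [map_smul, norm_smul, hcomm]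
      exact mul_le_mul (hale n) (R.le_opNorm _) (norm_nonneg _) (by positivity)
    · simpa using ((h0.comp (tendsto_add_atTop_nat N)).const_mul ‖R‖).const_mul (2 * β)

variable [CompleteSpace E] {lam : ℝ}

theorem tendsto_weylPairing (hα : 0 < α) (hsa : IsSelfAdjoint H) (hH : Nonnegative H)
    {ψ : ℕ → H.domain} (hn : ∀ n, ‖(ψ n : E)‖ = 1)
    (h : Tendsto (fun n => (1 - ((lam + α : ℝ) : ℂ) • shiftInv H α) (ψ n : E)) atTop (𝓝 0))
    (m : ℕ) : Tendsto (fun n => weylPairing H α lam (m + 1) (ψ n)) atTop (𝓝 0) := by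
  simp only [weylPairing_succ hα hsa hH]
  refine squeeze_zero_norm (fun n => (norm_inner_le_norm _ _).trans
    (mul_le_mul_of_nonneg_right ((shiftInv H α ^ m).le_opNorm _) (norm_nonneg _))) ?_
  simp only [hn]
  simpa using h.norm.const_mul (‖shiftInv H α ^ m‖ * 1)

theorem norm_sq_le_of_norm_weylPairing_le (hα : 0 < α) (hsa : IsSelfAdjoint H)
    (hH : Nonnegative H) (hlam : 0 ≤ lam) (ψ : H.domain) :
    ‖(1 - ((lam + α : ℝ) : ℂ) • shiftInv H α) (ψ : E)‖ ^ 2 ≤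
      ‖weylPairing H α lam 1 ψ‖ + (lam + α) * ‖weylPairing H α lam 2 ψ‖ := by
  have h := congrArg norm (norm_sq_eq_weylPairing hα hsa hH lam ψ)
  rw [Complex.norm_real, Real.norm_of_nonneg (by positivity)] at h
  rw [h]
  refine (norm_sub_le _ _).trans_eq ?_
  rw [norm_mul, Complex.norm_real, Real.norm_of_nonneg (by positivity)]

theorem tendsto_residual (hα : 0 < α) (hsa : IsSelfAdjoint H) (hH : Nonnegative H)
    (hlam : 0 ≤ lam) {ψ : ℕ → H.domain}
    (h : ∀ m ∈ ({1, 2} : Set ℕ),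
      Tendsto (fun j => weylPairing H α lam m (ψ j)) atTop (𝓝 0)) :
    Tendsto (fun n => (1 - ((lam + α : ℝ) : ℂ) • shiftInv H α) (ψ n : E)) atTop (𝓝 0) := by
  have h1 := (h 1 (by simp)).norm
  have h2 := ((h 2 (by simp)).norm.const_mul (lam + α))
  have h3 := squeeze_zero (fun n => sq_nonneg _)
    (fun n => norm_sq_le_of_norm_weylPairing_le hα hsa hH hlam (ψ n))
    (by simpa using h1.add h2)
  rw [tendsto_zero_iff_norm_tendsto_zero]
  simpa [Real.sqrt_sq] using h3.sqrt

theorem mem_spectrum_iff_not_isUnit (hα : 0 < α) (hsa : IsSelfAdjoint H)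
    (hH : Nonnegative H) (lam : ℝ) :
    (lam : ℂ) ∈ spectrum H ↔ ¬ IsUnit (1 - ((lam + α : ℝ) : ℂ) • shiftInv H α) := by
  rw [(isResolventAt_shiftInv hsa hH hα).mem_spectrum_iff, Complex.ofReal_add]

theorem mem_spectrum_iff_exists_seq (hsa : IsSelfAdjoint H) (hH : Nonnegative H)
    (hlam : 0 ≤ lam) :
    (lam : ℂ) ∈ spectrum H ↔ ∃ α : ℝ, 0 < α ∧ ∃ ψ : ℕ → H.domain, (∀ j, ‖(ψ j : E)‖ = 1) ∧
      (∀ m ∈ ({1, 2} : Set ℕ),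
        Tendsto (fun j => weylPairing H α lam m (ψ j)) atTop (𝓝 0)) := by
  constructor
  · intro h
    have hR := isResolventAt_shiftInv hsa hH one_pos
    have hT := isSelfAdjoint_one_sub_smul (hR.isSelfAdjoint hsa) (lam + 1)
    rw [mem_spectrum_iff_not_isUnit one_pos hsa hH] at h
    obtain ⟨φ, -, hφn, hφ⟩ := exists_unit_seq_tendsto_zero (K := ⊤)
      (T := 1 - ((lam + 1 : ℝ) : ℂ) • shiftInv H 1) (by
        rintro ⟨c, hc, hle⟩
        exact h (isUnit_of_isStarNormal_of_le_norm hT.isStarNormal hc fun x => hle x trivial))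
    obtain ⟨ψ, -, -, hψ, -, -, hTψ⟩ := exists_domain_seq hR (by positivity) hφn hφ
    refine ⟨1, one_pos, ψ, hψ, ?_⟩
    rintro m (rfl | rfl)
    · exact tendsto_weylPairing one_pos hsa hH hψ hTψ 0
    · exact tendsto_weylPairing one_pos hsa hH hψ hTψ 1
  · rintro ⟨α, hα, ψ, hψ, h⟩
    rw [mem_spectrum_iff_not_isUnit hα hsa hH]
    exact not_isUnit_of_tendsto hψ (tendsto_residual hα hsa hH hlam h)

theorem accPt_or_not_finiteDimensional_iff (hα : 0 < α) (hsa : IsSelfAdjoint H)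
    (hH : Nonnegative H) (hlam : 0 ≤ lam) :
    (AccPt (lam : ℂ) (𝓟 (spectrum H)) ∨ ¬ FiniteDimensional ℂ (eigenspace H lam)) ↔
      (AccPt 0 (𝓟 (_root_.spectrum ℂ (1 - ((lam + α : ℝ) : ℂ) • shiftInv H α))) ∨
        ¬ FiniteDimensional ℂ (1 - ((lam + α : ℝ) : ℂ) • shiftInv H α).ker) := by
  have hR := isResolventAt_shiftInv hsa hH hα
  have hβ : ((lam + α : ℝ) : ℂ) ≠ 0 := Complex.ofReal_ne_zero.mpr (by positivity)
  rw [hR.accPt_iff hβ (Complex.ofReal_add _ _).symm,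
    hR.eigenspace_eq (Complex.ofReal_add _ _).symm]

theorem mem_essentialSpectrum_iff_exists_seq (hsa : IsSelfAdjoint H) (hH : Nonnegative H)
    (hlam : 0 ≤ lam) :
    (lam : ℂ) ∈ essentialSpectrum H ↔
      ∃ α : ℝ, 0 < α ∧ ∃ ψ : ℕ → H.domain, (∀ j, ‖(ψ j : E)‖ = 1) ∧
        (∀ m ∈ ({1, 2} : Set ℕ),
          Tendsto (fun j => weylPairing H α lam m (ψ j)) atTop (𝓝 0)) ∧
        Tendsto (fun j => toWeakSpace ℂ E (ψ j : E)) atTop (𝓝 0) := by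
  constructor
  · rintro ⟨-, h⟩
    have hR := isResolventAt_shiftInv hsa hH one_pos
    have hRs := hR.isSelfAdjoint hsa
    have hT := isSelfAdjoint_one_sub_smul hRs (lam + 1)
    rw [accPt_or_not_finiteDimensional_iff one_pos hsa hH hlam] at h
    obtain ⟨φ, hφn, hφ, hw⟩ := exists_weaklyNull_seq hT h
    obtain ⟨ψ, a, N, hψ, ha, hψa, hTψ⟩ := exists_domain_seq hR (by positivity) hφn hφ
    refine ⟨1, one_pos, ψ, hψ, ?_, tendsto_toWeakSpace_zero_iff.mpr fun y => ?_⟩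
    · rintro m (rfl | rfl)
      · exact tendsto_weylPairing one_pos hsa hH hψ hTψ 0
      · exact tendsto_weylPairing one_pos hsa hH hψ hTψ 1
    -- Weak nullity passes from `φ` to `ψ`: `(y, a R φ) = a (R y, φ)` with `a` bounded.
    · have hadj : (shiftInv H 1).adjoint = shiftInv H 1 := hRs
      refine squeeze_zero_norm
        (a := fun n => 2 * (lam + 1) * ‖inner ℂ (shiftInv H 1 y) (φ (n + N))‖) (fun n => ?_) ?_
      · rw [hψa, inner_smul_right, norm_mul, ← ContinuousLinearMap.adjoint_inner_left, hadj]
        exact mul_le_mul_of_nonneg_right (ha n) (norm_nonneg _)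
      · simpa using (((hw (shiftInv H 1 y)).norm.comp (tendsto_add_atTop_nat N)).const_mul
          (2 * (lam + 1)))
  · rintro ⟨α, hα, ψ, hψ, h, hw⟩
    refine ⟨(mem_spectrum_iff_exists_seq hsa hH hlam).mpr ⟨α, hα, ψ, hψ, h⟩, ?_⟩
    have hT := isSelfAdjoint_one_sub_smul
      ((isResolventAt_shiftInv hsa hH hα).isSelfAdjoint hsa) (lam + α)
    rw [accPt_or_not_finiteDimensional_iff hα hsa hH hlam]
    exact accPt_or_not_finiteDimensional_of_weaklyNull_seq hT hψ
      (tendsto_residual hα hsa hH hlam h) (tendsto_toWeakSpace_zero_iff.mp hw)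

/-! ### The quantitative estimate (c). -/

/-- A spectral point within `2 β s` of `lam`, where `s ≤ 1 / 2` bounds the resolvent residual. -/
theorem exists_mem_spectrum_dist_le_of_residual_le (hα : 0 < α) (hsa : IsSelfAdjoint H)
    (hH : Nonnegative H) (hlam : 0 ≤ lam) {ψ : E} (hψ : ‖ψ‖ = 1) {s : ℝ} (hs : s ≤ 1 / 2)
    (h : ‖(1 - ((lam + α : ℝ) : ℂ) • shiftInv H α) ψ‖ ≤ s) :
    ∃ z ∈ spectrum H, dist (lam : ℂ) z ≤ 2 * (lam + α) * s := by
  have hR := isResolventAt_shiftInv hsa hH hα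
  have hT := isSelfAdjoint_one_sub_smul (hR.isSelfAdjoint hsa) (lam + α)
  obtain ⟨k, hk, hkn⟩ := exists_mem_spectrum_norm_le hT hψ
  have hks : ‖k‖ ≤ s := hkn.trans h
  have hβ : 0 < lam + α := by positivity
  have h1k : 1 / 2 ≤ ‖1 - k‖ := by
    have := norm_sub_norm_le 1 k
    rw [norm_one] at this
    linarith
  have hk1 : 1 - k ≠ 0 := norm_pos_iff.mp (by linarith)
  refine ⟨(lam + α : ℝ) / (1 - k) - α, (hR.mem_spectrum_iff_mem
    (Complex.ofReal_ne_zero.mpr hβ.ne') (by field_simp; ring)).mpr hk, ?_⟩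
  have e : (lam : ℂ) - ((lam + α : ℝ) / (1 - k) - α) = -((lam + α : ℝ) * k / (1 - k)) := by
    push_cast
    field_simp
    ring
  rw [dist_eq_norm, e, norm_neg, norm_div, norm_mul, Complex.norm_real,
    Real.norm_of_nonneg hβ.le, div_le_iff₀ (by linarith)]
  have h2 : (lam + α) * ‖k‖ ≤ (lam + α) * s := by gcongr
  have h3 : 0 ≤ (lam + α) * s := mul_nonneg hβ.le ((norm_nonneg _).trans hks)
  nlinarith

/-- A spectral point at a distance controlled by the first pairing only. -/
theorem exists_mem_spectrum_dist_le_of_weylPairing_le (hα : 0 < α) (hsa : IsSelfAdjoint H)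
    (hH : Nonnegative H) (hlam : 0 ≤ lam) {ψ : H.domain} (hψ : ‖(ψ : E)‖ = 1) {δ : ℝ}
    (hδ : δ < 1) (h : ‖weylPairing H α lam 1 ψ‖ ≤ δ) :
    ∃ z ∈ spectrum H, dist (lam : ℂ) z ≤ (lam + α) / (1 - δ) + (lam + α) := by
  have hR := isResolventAt_shiftInv hsa hH hα
  have hβ : 0 < lam + α := by positivity
  have : Nontrivial E := ⟨(ψ : E), 0, fun h0 => by simp [h0] at hψ⟩
  obtain ⟨k, hk, hkn⟩ := exists_mem_spectrum_norm_eq (hR.isSelfAdjoint hsa)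
  -- The first pairing is `1 - β (ψ, R ψ)`, and `|(ψ, R ψ)| ≤ ‖R‖ = ‖k‖`. The spectral point of `H`
  -- is then `k⁻¹ - α`.
  have hlow : 1 - δ ≤ (lam + α) * ‖k‖ := by
    have e : weylPairing H α lam 1 ψ =
        1 - ((lam + α : ℝ) : ℂ) * inner ℂ (ψ : E) (shiftInv H α (ψ : E)) := by
      rw [show (1 : ℕ) = 0 + 1 from rfl, weylPairing_succ hα hsa hH, pow_zero]
      simp only [one_apply_eq_self, sub_apply, smul_apply, inner_sub_right, inner_smul_right]
      rw [inner_self_eq_norm_sq_to_K, hψ]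
      simp
    have h1 := norm_sub_norm_le (1 : ℂ)
      (((lam + α : ℝ) : ℂ) * inner ℂ (ψ : E) (shiftInv H α (ψ : E)))
    rw [← e, norm_one, norm_mul, Complex.norm_real, Real.norm_of_nonneg hβ.le] at h1
    have h2 : ‖inner ℂ (ψ : E) (shiftInv H α (ψ : E))‖ ≤ ‖k‖ := by
      have h3 := norm_inner_le_norm (𝕜 := ℂ) (ψ : E) (shiftInv H α (ψ : E))
      have h4 := (shiftInv H α).le_opNorm (ψ : E)
      rw [hψ] at h3 h4
      linarith
    have h5 := mul_le_mul_of_nonneg_left h2 hβ.le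
    linarith
  have hkpos : 0 < ‖k‖ := by
    by_contra hc
    nlinarith
  have hk0 : k ≠ 0 := norm_pos_iff.mp hkpos
  refine ⟨k⁻¹ - α, ?_, ?_⟩
  · rw [hR.mem_spectrum_iff, sub_add_cancel]
    rw [_root_.spectrum.mem_iff] at hk
    have e : algebraMap ℂ (E →L[ℂ] E) k - shiftInv H α
        = Units.mk0 k hk0 • (1 - k⁻¹ • shiftInv H α) := by
      rw [Units.smul_mk0, smul_sub, smul_smul, mul_inv_cancel₀ hk0, one_smul,
        Algebra.algebraMap_eq_smul_one]
    rwa [e, isUnit_smul_iff] at hk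
  · have e : (lam : ℂ) - (k⁻¹ - α) = ((lam + α : ℝ) : ℂ) - k⁻¹ := by push_cast; ring
    rw [dist_eq_norm, e]
    refine (norm_sub_le _ _).trans ?_
    rw [Complex.norm_real, Real.norm_of_nonneg hβ.le, norm_inv, add_comm]
    gcongr
    rw [inv_le_iff_one_le_mul₀ hkpos, div_mul_eq_mul_div, one_le_div (by linarith)]
    exact hlow

/-- The constant adds the bounds from two regimes, split at `(1 + β) δ = 1/4`. With `t = δ^(1/3) ≤
1`, small `δ` gives a residual at most `(1 + β) t`, because `δ = t³ ≤ t²`; otherwise `4 (1 + β) t >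
1` absorbs the fixed distance `M`. -/
theorem exists_mem_spectrum_dist_lt (hα : 0 < α) (hsa : IsSelfAdjoint H)
    (hH : Nonnegative H) (hlam : 0 ≤ lam) {δ₀ δ : ℝ} (hδ₀ : δ₀ < 1) (hδ : 0 < δ)
    (hle : δ ≤ δ₀) {ψ : H.domain} (hψ : ‖(ψ : E)‖ = 1)
    (h1 : ‖weylPairing H α lam 1 ψ‖ ≤ δ) (h2 : ‖weylPairing H α lam 2 ψ‖ ≤ δ) :
    ∃ z ∈ spectrum H, dist (lam : ℂ) z <
      (4 * (1 + (lam + α)) * ((lam + α) / (1 - δ₀) + (lam + α)) +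
        2 * (lam + α) * (1 + (lam + α))) * δ ^ (1 / 3 : ℝ) := by
  have hβ : 0 < lam + α := by positivity
  set β := lam + α with hβdef
  set t := δ ^ (1 / 3 : ℝ) with ht
  have htpos : 0 < t := Real.rpow_pos_of_pos hδ _
  have ht3 : t ^ 3 = δ := by
    rw [ht, ← Real.rpow_natCast, ← Real.rpow_mul hδ.le]
    norm_num
  have ht1 : t ≤ 1 := Real.rpow_le_one hδ.le (by linarith) (by norm_num)
  set M := β / (1 - δ₀) + β with hM
  have hMpos : 0 < M := by
    have : 0 < 1 - δ₀ := by linarith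
    positivity
  have hsq : ‖(1 - ((lam + α : ℝ) : ℂ) • shiftInv H α) (ψ : E)‖ ^ 2 ≤ (1 + β) * δ := by
    have h3 := norm_sq_le_of_norm_weylPairing_le hα hsa hH hlam ψ
    have h4 := mul_le_mul_of_nonneg_left h2 hβ.le
    linarith
  by_cases hsmall : (1 + β) * δ ≤ 1 / 4
  · have hs : ‖(1 - ((lam + α : ℝ) : ℂ) • shiftInv H α) (ψ : E)‖ ≤ 1 / 2 :=
      abs_le_of_sq_le_sq' (by linarith) (by norm_num) |>.2
    obtain ⟨z, hz, hd⟩ := exists_mem_spectrum_dist_le_of_residual_le hα hsa hH hlam hψ hs le_rfl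
    refine ⟨z, hz, hd.trans_lt ?_⟩
    have hst : ‖(1 - ((lam + α : ℝ) : ℂ) • shiftInv H α) (ψ : E)‖ ≤ (1 + β) * t := by
      refine abs_le_of_sq_le_sq' (hsq.trans ?_) (by positivity) |>.2
      rw [← ht3, mul_pow]
      have h5 : t ^ 3 ≤ t ^ 2 := pow_le_pow_of_le_one htpos.le ht1 (by norm_num)
      have h6 : 1 + β ≤ (1 + β) ^ 2 := by nlinarith
      exact mul_le_mul h6 h5 (by positivity) (by positivity)
    have h7 : 2 * β * ‖(1 - ((lam + α : ℝ) : ℂ) • shiftInv H α) (ψ : E)‖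
        ≤ 2 * β * ((1 + β) * t) := by gcongr
    have h8 : 0 < 4 * (1 + β) * M * t := by positivity
    linarith
  · obtain ⟨z, hz, hd⟩ := exists_mem_spectrum_dist_le_of_weylPairing_le hα hsa hH hlam hψ hδ₀
      (h1.trans hle)
    refine ⟨z, hz, hd.trans_lt ?_⟩
    have h5 : t ^ 3 ≤ t := by simpa using pow_le_pow_of_le_one htpos.le ht1 (show 1 ≤ 3 by norm_num)
    have h6 : 1 < 4 * (1 + β) * t := by
      have : (1 + β) * δ ≤ (1 + β) * t := by rw [← ht3]; gcongr
      linarith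
    have h7 : M * 1 < M * (4 * (1 + β) * t) := mul_lt_mul_of_pos_left h6 hMpos
    have h8 : 0 < 2 * β * (1 + β) * t := by positivity
    linarith

end Criteria

end WeylCriterion

theorem corollary2p3 :
    -- The criteria for the spectrum and for the essential spectrum.
    (∀ (E : Type u) [NormedAddCommGroup E] [InnerProductSpace ℂ E] [CompleteSpace E]
      (H : E →ₗ.[ℂ] E), IsSelfAdjoint H → WeylCriterion.Nonnegative H →
      ∀ lam : ℝ, 0 ≤ lam →
        ((lam : ℂ) ∈ WeylCriterion.spectrum H ↔
          ∃ α : ℝ, 0 < α ∧ ∃ ψ : ℕ → H.domain,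
            (∀ j, ‖(ψ j : E)‖ = 1) ∧
            (∀ m ∈ ({1, 2} : Set ℕ),
              Tendsto (fun j => WeylCriterion.weylPairing H α lam m (ψ j)) atTop (𝓝 0))) ∧
        ((lam : ℂ) ∈ WeylCriterion.essentialSpectrum H ↔
          ∃ α : ℝ, 0 < α ∧ ∃ ψ : ℕ → H.domain,
            (∀ j, ‖(ψ j : E)‖ = 1) ∧
            (∀ m ∈ ({1, 2} : Set ℕ),
              Tendsto (fun j => WeylCriterion.weylPairing H α lam m (ψ j)) atTop (𝓝 0)) ∧
            Tendsto (fun j => toWeakSpace ℂ E (ψ j : E)) atTop (𝓝 0))) ∧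
    -- The quantitative estimate; `c` is chosen before the space, the operator and `δ`.
    (∀ lam α δ₀ : ℝ, 0 ≤ lam → 0 < α → 0 < δ₀ → δ₀ < 1 →
      ∃ c : ℝ, 0 < c ∧
        ∀ (E : Type u) [NormedAddCommGroup E] [InnerProductSpace ℂ E] [CompleteSpace E]
          (H : E →ₗ.[ℂ] E), IsSelfAdjoint H → WeylCriterion.Nonnegative H →
          ∀ δ : ℝ, 0 < δ → δ ≤ δ₀ →
          ∀ ψ : ℕ → H.domain, (∀ j, ‖(ψ j : E)‖ = 1) →
            (∀ m ∈ ({1, 2} : Set ℕ), ∀ j, ‖WeylCriterion.weylPairing H α lam m (ψ j)‖ ≤ δ) →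
            (WeylCriterion.spectrum H).Nonempty ∧
              Metric.infDist (lam : ℂ) (WeylCriterion.spectrum H) <
                c * δ ^ (1 / 3 : ℝ)) := by
  refine ⟨fun E _ _ _ H hsa hH lam hlam =>
    ⟨WeylCriterion.mem_spectrum_iff_exists_seq hsa hH hlam,
      WeylCriterion.mem_essentialSpectrum_iff_exists_seq hsa hH hlam⟩,
    fun lam α δ₀ hlam hα _ hδ₀ =>
      ⟨4 * (1 + (lam + α)) * ((lam + α) / (1 - δ₀) + (lam + α)) +
        2 * (lam + α) * (1 + (lam + α)), ?_, fun E _ _ _ H hsa hH δ hδ hle ψ hψ h => ?_⟩⟩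
  · have : 0 < 1 - δ₀ := by linarith
    positivity
  -- The pairing bounds are uniform in `j`, so a single vector of the sequence suffices.
  · obtain ⟨z, hz, hd⟩ := WeylCriterion.exists_mem_spectrum_dist_lt hα hsa hH hlam hδ₀ hδ hle
      (hψ 0) (h 1 (by simp) 0) (h 2 (by simp) 0)
    exact ⟨⟨z, hz⟩, (Metric.infDist_le_dist_of_mem hz).trans_lt hd⟩
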